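/- Let $A\colon H\supseteq D(A)\to H$ be a (bounded or unbounded) anti-self-adjoint linear operator in a complex Hilbert space $H$, i.e. $D(A)$ is dense in $H$ and $A^*=-A$ (with $D(A^*)=D(A)$). Then $A$ generates a unique strongly continuous group $\{e^{tA}\}_{t\in\mathbb R}$ of bounded linear operators on $H$, that is, there is a unique family $\{e^{tA}\}_{t\in\mathbb R}$ of bounded linear operators with $e^{0A}=I$, $e^{(s+t)A}=e^{sA}e^{tA}$ for all $s,t\in\mathbb R$ and $t\mapsto e^{tA}f$ continuous on $\mathbb R$ for every $f\in H$, such that $D(A)$ is the set of all $f\in H$ for which $\lim_{t\to0}\frac{e^{tA}f-f}{t}$ exists, and $Af$ equals this limit for $f\in D(A)$. This group is unitary, i.e. every $e^{tA}$, $t\in\mathbb R$, is a unitary operator on $H$; it is bounded, i.e. $\sup_{t\in\mathbb R}\|e^{tA}\|<\infty$; and it is not hypercyclic, i.e. there is no nonzero vector $f\in H$ whose orbit $\{e^{tA}f\}_{t\in\mathbb R}$ is dense in $H$. -/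

import Mathlib

/-- A (possibly unbounded) operator `A` in a complex Hilbert space is anti-self-adjoint if it is
densely defined and `A* = -A`, equality of domains included. -/
def IsAntiSelfAdjoint {H : Type*} [NormedAddCommGroup H] [InnerProductSpace ℂ H] [CompleteSpace H]
    (A : H →ₗ.[ℂ] H) : Prop :=
  Dense (A.domain : Set H) ∧ A.adjoint = -A

/-- A strongly continuous (one-parameter) group of bounded linear operators on a complex normed
space. -/
@[ext]
structure StronglyContinuousGroup (X : Type*) [NormedAddCommGroup X] [NormedSpace ℂ X] where
  /-- The operators of the group. -/
  op : ℝ → X →L[ℂ] X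
  op_zero : op 0 = 1
  op_add : ∀ s t : ℝ, op (s + t) = op s * op t
  continuous_orbit : ∀ f : X, Continuous fun t : ℝ => op t f

/-- The generator of a strongly continuous group `T`: its domain consists of all `f` for which
`lim_{t → 0} t⁻¹ (T(t) f - f)` exists, that is, for which the orbit `t ↦ T(t) f` is differentiable
at `0` (recall `T(0) f = f`), and its value at such an `f` is that limit. -/
noncomputable def StronglyContinuousGroup.generator {X : Type*} [NormedAddCommGroup X]
    [NormedSpace ℂ X] (T : StronglyContinuousGroup X) : X →ₗ.[ℂ] X where
  domain :=
    { carrier := {f | DifferentiableAt ℝ (fun t : ℝ => T.op t f) 0}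
      zero_mem' := by simp
      add_mem' := fun {f g} hf hg => by
        simpa using DifferentiableAt.fun_add hf hg
      smul_mem' := fun c f hf => by
        simpa using DifferentiableAt.fun_const_smul hf c }
  toFun :=
    { toFun := fun f => deriv (fun t : ℝ => T.op t (f : X)) 0
      map_add' := fun f g => by
        simpa using deriv_fun_add f.2 g.2
      map_smul' := fun c f => by
        simpa using deriv_fun_const_smul c f.2 }

/-- `f` is a hypercyclic vector of a collection `T` of (not necessarily bounded or everywhere
defined) linear operators: it is nonzero, belongs to the domain of every `T j`, and its orbit
`{T j f}` is dense. -/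
def IsHypercyclicVector {J X : Type*} [NormedAddCommGroup X] [NormedSpace ℂ X]
    (T : J → X →ₗ.[ℂ] X) (f : X) : Prop :=
  f ≠ 0 ∧ ∃ hf : ∀ j, f ∈ (T j).domain, Dense (Set.range fun j => T j ⟨f, hf j⟩)

/-- A collection of linear operators is hypercyclic if it possesses a hypercyclic vector. -/
def IsHypercyclic {J X : Type*} [Nonempty J] [NormedAddCommGroup X] [NormedSpace ℂ X]
    (T : J → X →ₗ.[ℂ] X) : Prop :=
  ∃ f : X, IsHypercyclicVector T f

/-! The group is a strong limit of exponentials of bounded skew-adjoint operators.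
Anti-self-adjointness gives `‖c x - A x‖² = c²‖x‖² + ‖A x‖²` for real `c`, and with the maximality
in `exists_apply_eq` this makes `c - A` bijective for `c ≠ 0`. The resolvents commute, and suitable
combinations of them (`yosida`) are bounded, skew-adjoint, commuting, and converge to `A` on its
domain. Their exponentials are isometries, so every estimate is uniform in `n` and the limit `expOp`
exists by density.

The limit inherits the group law and the isometry property. Its generator extends `A`, and
maximality turns this into equality. Uniqueness holds because solutions of `u' = A u` have constant
norm. An isometric orbit stays on a sphere, hence is not dense. -/

open Filter Topology

section Approximation

variable {H : Type*} [NormedAddCommGroup H] [NormedSpace ℂ H]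

/-- Pointwise Cauchy convergence of a sequence of contractions on a dense set is Cauchy
convergence everywhere. -/
theorem cauchySeq_apply_of_dense {B : ℕ → H →L[ℂ] H} (hB : ∀ n x, ‖B n x‖ ≤ ‖x‖) {s : Set H}
    (hs : Dense s) (h : ∀ x ∈ s, CauchySeq fun n => B n x) (x : H) :
    CauchySeq fun n => B n x := by
  rw [Metric.cauchySeq_iff]
  intro ε hε
  obtain ⟨y, hy, hxy⟩ := hs.exists_dist_lt x (show 0 < ε / 3 by positivity)
  obtain ⟨N, hN⟩ := Metric.cauchySeq_iff.1 (h y hy) (ε / 3) (by positivity)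
  refine ⟨N, fun m hm n hn => ?_⟩
  have key : ∀ k, dist (B k x) (B k y) ≤ dist x y := fun k => by
    rw [dist_eq_norm, dist_eq_norm, ← map_sub]; exact hB k _
  have h1 := key m
  have h2 := key n
  have h3 := hN m hm n hn
  have h4 := dist_triangle4 (B m x) (B m y) (B n y) (B n x)
  rw [dist_comm (B n y)] at h4
  linarith

/-- Pointwise convergence of a sequence of contractions to the identity on a dense set is
pointwise convergence to the identity everywhere. -/
theorem tendsto_apply_self_of_dense {ι : Type*} {l : Filter ι} {B : ι → H →L[ℂ] H}
    (hB : ∀ i x, ‖B i x‖ ≤ ‖x‖) {s : Set H} (hs : Dense s)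
    (h : ∀ x ∈ s, Tendsto (fun i => B i x) l (𝓝 x)) (x : H) :
    Tendsto (fun i => B i x) l (𝓝 x) := by
  rw [Metric.tendsto_nhds]
  intro ε hε
  obtain ⟨y, hy, hxy⟩ := hs.exists_dist_lt x (show 0 < ε / 3 by positivity)
  filter_upwards [Metric.tendsto_nhds.1 (h y hy) (ε / 3) (by positivity)] with i hi
  have h1 : dist (B i x) (B i y) ≤ dist x y := by
    rw [dist_eq_norm, dist_eq_norm, ← map_sub]; exact hB i _
  have h4 := dist_triangle4 (B i x) (B i y) y x
  rw [dist_comm y x] at h4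
  linarith

end Approximation

/-! ### Norm estimates for exponentials of bounded skew-adjoint operators. -/

section SkewExponential

variable {H : Type*} [NormedAddCommGroup H] [InnerProductSpace ℂ H] [CompleteSpace H]

open NormedSpace

theorem exp_real_smul_mem_unitary {K : H →L[ℂ] H} (hK : K ∈ skewAdjoint (H →L[ℂ] H)) (t : ℝ) :
    exp (t • K) ∈ unitary (H →L[ℂ] H) :=
  let _ := NormedAlgebra.restrictScalars ℚ ℂ (H →L[ℂ] H)
  exp_mem_unitary_of_mem_skewAdjoint (skewAdjoint.smul_mem t hK)

theorem norm_exp_real_smul_apply {K : H →L[ℂ] H} (hK : K ∈ skewAdjoint (H →L[ℂ] H)) (t : ℝ)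
    (x : H) : ‖exp (t • K) x‖ = ‖x‖ :=
  ContinuousLinearMap.norm_map_of_mem_unitary (exp_real_smul_mem_unitary hK t) x

theorem hasDerivAt_exp_real_smul_apply (K : H →L[ℂ] H) (x : H) (t : ℝ) :
    HasDerivAt (fun s : ℝ => exp (s • K) x) (exp (t • K) (K x)) t := by
  have h := hasDerivAt_exp_smul_const (𝕂 := ℝ) K t
  exact ((ContinuousLinearMap.apply ℂ H x).restrictScalars ℝ).hasFDerivAt.comp_hasDerivAt t h

theorem norm_sub_le_of_hasDerivAt_of_bound {E : Type*} [NormedAddCommGroup E] [NormedSpace ℝ E]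
    {u u' : ℝ → E} {C t : ℝ} (hu : ∀ s, HasDerivAt u (u' s) s)
    (hC : ∀ s, |s| ≤ |t| → ‖u' s‖ ≤ C) : ‖u t - u 0‖ ≤ C * |t| := by
  have h := (convex_closedBall (0 : ℝ) |t|).norm_image_sub_le_of_norm_hasDerivWithin_le
    (f := u) (f' := u') (C := C) (x := 0) (y := t)
    (fun s _ => (hu s).hasDerivWithinAt) (fun s hs => hC s (by simpa using hs))
    (by simp) (by simp)
  simpa using h

theorem norm_exp_real_smul_apply_sub_le {K : H →L[ℂ] H} (hK : K ∈ skewAdjoint (H →L[ℂ] H))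
    (t : ℝ) (x : H) : ‖exp (t • K) x - x‖ ≤ ‖K x‖ * |t| := by
  have h := norm_sub_le_of_hasDerivAt_of_bound (t := t) (hasDerivAt_exp_real_smul_apply K x)
    (C := ‖K x‖) fun s _ => (norm_exp_real_smul_apply hK s _).le
  simpa using h

/-- Commutation lets the isometry `exp (t • L)` be factored out, leaving the exponential of the
skew-adjoint `K - L`. The bound sees `K` and `L` only through `K x - L x`, so it survives unbounded
norms. -/
theorem norm_exp_sub_exp_apply_le {K L : H →L[ℂ] H} (hK : K ∈ skewAdjoint (H →L[ℂ] H))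
    (hL : L ∈ skewAdjoint (H →L[ℂ] H)) (hKL : Commute K L) (t : ℝ) (x : H) :
    ‖exp (t • K) x - exp (t • L) x‖ ≤ ‖K x - L x‖ * |t| := by
  let _ := NormedAlgebra.restrictScalars ℚ ℂ (H →L[ℂ] H)
  have h1 : exp (t • K) = exp (t • L) * exp (t • (K - L)) := by
    rw [← exp_add_of_commute, ← smul_add, add_sub_cancel]
    exact ((hKL.symm.sub_right (Commute.refl L)).smul_left t).smul_right t
  rw [h1, mul_apply_eq_comp, ← map_sub, norm_exp_real_smul_apply hL]
  exact norm_exp_real_smul_apply_sub_le (sub_mem hK hL) t x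

/-- First order expansion of the exponential of a skew-adjoint operator with an error that does
not involve the norm of the operator. -/
theorem norm_exp_real_smul_apply_sub_sub_le {K : H →L[ℂ] H}
    (hK : K ∈ skewAdjoint (H →L[ℂ] H)) (t : ℝ) (x g h : H) :
    ‖exp (t • K) x - x - t • g‖ ≤ (‖K x - g‖ + (2 * ‖g - h‖ + ‖K h‖ * |t|)) * |t| := by
  have hd : ∀ s : ℝ, HasDerivAt (fun s : ℝ => exp (s • K) x - s • g)
      (exp (s • K) (K x) - g) s := fun s => by
    simpa using (hasDerivAt_exp_real_smul_apply K x s).fun_sub ((hasDerivAt_id s).smul_const g)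
  have := norm_sub_le_of_hasDerivAt_of_bound (t := t) hd
    (C := ‖K x - g‖ + (2 * ‖g - h‖ + ‖K h‖ * |t|)) ?_
  · simpa [sub_right_comm] using this
  intro s hs
  -- `h` replaces `g` where `K` must be applied: in the application `g = A x` may lie outside the
  -- domain of `A`, while `h` lies in it.
  have e : exp (s • K) (K x) - g
      = exp (s • K) (K x - g) + (exp (s • K) (g - h) + (exp (s • K) h - h) - (g - h)) := by
    simp only [map_sub]; abel
  rw [e]
  refine (norm_add_le _ _).trans ?_
  rw [norm_exp_real_smul_apply hK]
  gcongr
  refine (norm_sub_le _ _).trans ?_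
  have h1 := norm_add_le (exp (s • K) (g - h)) (exp (s • K) h - h)
  rw [norm_exp_real_smul_apply hK] at h1
  have h2 := norm_exp_real_smul_apply_sub_le hK s h
  have h3 : ‖K h‖ * |s| ≤ ‖K h‖ * |t| := by gcongr
  linarith

end SkewExponential

/-! ### Resolvents and bounded approximations of an anti-self-adjoint operator. -/

namespace IsAntiSelfAdjoint

variable {H : Type*} [NormedAddCommGroup H] [InnerProductSpace ℂ H] {A : H →ₗ.[ℂ] H}

/-- The operator `c - A` on the domain of `A`. -/
def smulSub (A : H →ₗ.[ℂ] H) (c : ℝ) : A.domain →ₗ[ℂ] H :=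
  (c : ℂ) • A.domain.subtype - A.toFun

theorem smulSub_apply (c : ℝ) (x : A.domain) : smulSub A c x = (c : ℂ) • (x : H) - A x := rfl

variable [CompleteSpace H]

/-- Maximality of `A`: a weak solution of `A x = y` lies in the domain of `A*`, which is that of
`A`. Closedness of the graph, surjectivity of `c - A` and the identification of the generator all
rest on this. -/
theorem exists_apply_eq (hA : IsAntiSelfAdjoint A) {x y : H}
    (h : ∀ g : A.domain, inner ℂ y (g : H) = -inner ℂ x (A g)) :
    ∃ hx : x ∈ A.domain, A ⟨x, hx⟩ = y := by
  have h' : ∀ g : A.domain, inner ℂ (-y) (g : H) = inner ℂ x (A g) := fun g => by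
    rw [inner_neg_left, h, neg_neg]
  have hx : x ∈ A.adjoint.domain := A.mem_adjoint_domain_of_exists x ⟨-y, h'⟩
  have h2 : A.adjoint ⟨x, hx⟩ = -y := A.adjoint_apply_eq hA.1 ⟨x, hx⟩ h'
  have h3 : A.adjoint.domain = A.domain := by rw [hA.2]; rfl
  refine ⟨h3 ▸ hx, ?_⟩
  have h4 := (LinearPMap.ext_iff.1 hA.2).2 (x := x) (hf := hx) (hg := h3 ▸ hx)
  rw [h2, LinearPMap.neg_apply] at h4
  exact (neg_injective h4).symm

theorem inner_apply_left (hA : IsAntiSelfAdjoint A) (x y : A.domain) :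
    inner ℂ (A x) (y : H) = -inner ℂ (x : H) (A y) := by
  have h3 : A.adjoint.domain = A.domain := by rw [hA.2]; rfl
  have hx : (x : H) ∈ A.adjoint.domain := by rw [h3]; exact x.2
  have h := A.adjoint_isFormalAdjoint hA.1 ⟨x, hx⟩ y
  have h4 := (LinearPMap.ext_iff.1 hA.2).2 (x := x) (hf := hx) (hg := x.2)
  rw [h4, LinearPMap.neg_apply, inner_neg_left] at h
  exact neg_eq_iff_eq_neg.1 h

theorem re_inner_apply_self (hA : IsAntiSelfAdjoint A) (x : A.domain) :
    (inner ℂ (x : H) (A x)).re = 0 := by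
  have h := hA.inner_apply_left x x
  have h2 : (inner ℂ (A x) (x : H)).re = (inner ℂ (x : H) (A x)).re :=
    inner_re_symm (𝕜 := ℂ) _ _
  rw [h, Complex.neg_re] at h2
  linarith

/-- The cross term vanishes because `⟨x, A x⟩` is purely imaginary and `c` is real. -/
theorem norm_smul_sub_sq (hA : IsAntiSelfAdjoint A) (c : ℝ) (x : A.domain) :
    ‖(c : ℂ) • (x : H) - A x‖ ^ 2 = (|c| * ‖(x : H)‖) ^ 2 + ‖A x‖ ^ 2 := by
  rw [norm_sub_sq (𝕜 := ℂ), inner_smul_left]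
  have := hA.re_inner_apply_self x
  simp [norm_smul, this]

theorem norm_le_norm_smul_sub (hA : IsAntiSelfAdjoint A) (c : ℝ) (x : A.domain) :
    |c| * ‖(x : H)‖ ≤ ‖(c : ℂ) • (x : H) - A x‖ ∧ ‖A x‖ ≤ ‖(c : ℂ) • (x : H) - A x‖ := by
  have h := hA.norm_smul_sub_sq c x
  constructor <;> refine le_of_sq_le_sq ?_ (norm_nonneg _) <;> rw [h] <;>
    nlinarith [sq_nonneg (|c| * ‖(x : H)‖), sq_nonneg ‖A x‖]

theorem isClosed_graph (hA : IsAntiSelfAdjoint A) : IsClosed (A.graph : Set (H × H)) := by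
  have : (A.graph : Set (H × H)) =
      ⋂ g : A.domain, {p | inner ℂ p.2 (g : H) = -inner ℂ p.1 (A g)} := by
    ext p
    simp only [SetLike.mem_coe, LinearPMap.mem_graph_iff, Set.mem_iInter, Set.mem_ofPred_eq]
    constructor
    · rintro ⟨y, h1, h2⟩ g
      rw [← h1, ← h2]
      exact hA.inner_apply_left y g
    · intro h
      obtain ⟨hx, h2⟩ := hA.exists_apply_eq h
      exact ⟨⟨p.1, hx⟩, rfl, h2⟩
  rw [this]
  refine isClosed_iInter fun g => isClosed_eq ?_ ?_ <;> fun_prop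

theorem smulSub_injective (hA : IsAntiSelfAdjoint A) {c : ℝ} (hc : c ≠ 0) :
    Function.Injective (smulSub A c) := by
  rw [injective_iff_map_eq_zero]
  intro x hx
  have h := (hA.norm_le_norm_smul_sub c x).1
  rw [← smulSub_apply, hx, norm_zero] at h
  have : ‖(x : H)‖ = 0 := by
    have := abs_pos.2 hc
    nlinarith [norm_nonneg (x : H)]
  exact Subtype.ext (norm_eq_zero.1 this)

theorem isClosed_range_smulSub (hA : IsAntiSelfAdjoint A) {c : ℝ} (hc : c ≠ 0) :
    IsClosed (LinearMap.range (smulSub A c) : Set H) := by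
  have : CompleteSpace A.graph := hA.isClosed_graph.completeSpace_coe
  let F : A.graph →L[ℂ] H :=
    ((c : ℂ) • ContinuousLinearMap.fst ℂ H H - ContinuousLinearMap.snd ℂ H H).comp
      A.graph.subtypeL
  have hF : ∀ x : A.domain, ∀ h, F ⟨((x : H), A x), h⟩ = smulSub A c x := fun x h => rfl
  have hr : (LinearMap.range (smulSub A c) : Set H) = Set.range F := by
    ext y
    constructor
    · rintro ⟨x, rfl⟩
      exact ⟨⟨(x, A x), A.mem_graph x⟩, rfl⟩
    · rintro ⟨⟨⟨a, b⟩, hp⟩, rfl⟩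
      obtain ⟨x, h1, h2⟩ := (LinearPMap.mem_graph_iff A).1 hp
      dsimp only at h1 h2
      subst h1 h2
      exact ⟨x, rfl⟩
  rw [hr]
  -- The graph carries the max norm, so `|c|⁻¹` controls the first component and `1` the second.
  have hanti : AntilipschitzWith (max ⟨|c|⁻¹, by positivity⟩ 1) F := by
    refine AddMonoidHomClass.antilipschitz_of_bound F ?_
    rintro ⟨⟨a, b⟩, hp⟩
    obtain ⟨x, h1, h2⟩ := (LinearPMap.mem_graph_iff A).1 hp
    dsimp only at h1 h2
    subst h1 h2
    rw [hF, smulSub_apply]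
    obtain ⟨h1, h2⟩ := hA.norm_le_norm_smul_sub c x
    have hc' := abs_pos.2 hc
    refine max_le ?_ ?_
    · calc ‖(x : H)‖ ≤ |c|⁻¹ * ‖(c : ℂ) • (x : H) - A x‖ := by
            rw [inv_mul_eq_div, le_div_iff₀ hc']; linarith
        _ ≤ _ := by gcongr; exact le_max_left _ _
    · calc ‖A x‖ ≤ 1 * ‖(c : ℂ) • (x : H) - A x‖ := by rwa [one_mul]
        _ ≤ _ := by gcongr; exact le_max_right _ _
  exact hanti.isClosed_range F.uniformContinuous

theorem smulSub_surjective (hA : IsAntiSelfAdjoint A) {c : ℝ} (hc : c ≠ 0) :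
    Function.Surjective (smulSub A c) := by
  rw [← LinearMap.range_eq_top]
  have : CompleteSpace (LinearMap.range (smulSub A c)) :=
    (hA.isClosed_range_smulSub hc).completeSpace_coe
  rw [← Submodule.orthogonal_eq_bot_iff, Submodule.eq_bot_iff]
  intro y hy
  -- Orthogonality to the range is the weak form of `A y = -c y`, so `y` lies in the kernel of `-c -
  -- A`, which is trivial.
  have h : ∀ g : A.domain, inner ℂ (-((c : ℂ) • y)) (g : H) = -inner ℂ y (A g) := fun g => by
    have := (Submodule.mem_orthogonal' _ _).1 hy _ ⟨g, rfl⟩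
    rw [smulSub_apply, inner_sub_right, inner_smul_right, sub_eq_zero] at this
    rw [← this, inner_neg_left, inner_smul_left, Complex.conj_ofReal]
  obtain ⟨hy', h2⟩ := hA.exists_apply_eq h
  have h3 : smulSub A (-c) ⟨y, hy'⟩ = 0 := by
    rw [smulSub_apply, h2]; simp
  have := hA.smulSub_injective (neg_ne_zero.2 hc) (h3.trans (map_zero _).symm)
  exact congrArg Subtype.val this

theorem exists_resolvent (hA : IsAntiSelfAdjoint A) {c : ℝ} (hc : c ≠ 0) :
    ∃ R : H →L[ℂ] H, ∀ x, ∃ h : R x ∈ A.domain, (c : ℂ) • R x - A ⟨R x, h⟩ = x := by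
  let e := LinearEquiv.ofBijective (smulSub A c)
    ⟨hA.smulSub_injective hc, hA.smulSub_surjective hc⟩
  have he : ∀ x, (c : ℂ) • (e.symm x : H) - A (e.symm x) = x := fun x =>
    e.apply_symm_apply x
  refine ⟨(A.domain.subtype ∘ₗ e.symm.toLinearMap).mkContinuous |c|⁻¹ fun x => ?_,
    fun x => ⟨(e.symm x).2, he x⟩⟩
  have h := (hA.norm_le_norm_smul_sub c (e.symm x)).1
  rw [he] at h
  rw [inv_mul_eq_div, le_div_iff₀ (abs_pos.2 hc), mul_comm]
  exact h

open Classical in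
/-- The resolvent `(c - A)⁻¹` of `A` at a nonzero real `c` (and `0` at `c = 0`). -/
noncomputable def resolvent (hA : IsAntiSelfAdjoint A) (c : ℝ) : H →L[ℂ] H :=
  if hc : c ≠ 0 then (hA.exists_resolvent hc).choose else 0

theorem resolvent_mem (hA : IsAntiSelfAdjoint A) (c : ℝ) (x : H) :
    hA.resolvent c x ∈ A.domain := by
  by_cases hc : c ≠ 0
  · rw [resolvent, dif_pos hc]
    exact ((hA.exists_resolvent hc).choose_spec x).1
  · rw [resolvent, dif_neg hc]
    exact zero_mem _

theorem smulSub_resolvent (hA : IsAntiSelfAdjoint A) {c : ℝ} (hc : c ≠ 0) (x : H) :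
    smulSub A c ⟨hA.resolvent c x, hA.resolvent_mem c x⟩ = x := by
  obtain ⟨h, h'⟩ := (hA.exists_resolvent hc).choose_spec x
  convert h' using 1
  simp only [smulSub_apply, resolvent, dif_pos hc]

theorem resolvent_smulSub (hA : IsAntiSelfAdjoint A) {c : ℝ} (hc : c ≠ 0) (x : A.domain) :
    hA.resolvent c (smulSub A c x) = x :=
  congrArg Subtype.val (hA.smulSub_injective hc (hA.smulSub_resolvent hc (smulSub A c x)))

theorem norm_smul_resolvent_le (hA : IsAntiSelfAdjoint A) {c : ℝ} (hc : c ≠ 0) (x : H) :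
    ‖((c : ℂ) • hA.resolvent c) x‖ ≤ ‖x‖ := by
  have h := (hA.norm_le_norm_smul_sub c ⟨hA.resolvent c x, hA.resolvent_mem c x⟩).1
  rw [← smulSub_apply, hA.smulSub_resolvent hc] at h
  simpa [norm_smul] using h

theorem smul_resolvent_apply (hA : IsAntiSelfAdjoint A) {c : ℝ} (hc : c ≠ 0) (x : A.domain) :
    (c : ℂ) • hA.resolvent c (x : H) = x + hA.resolvent c (A x) := by
  rw [← map_smul, ← sub_eq_iff_eq_add, ← map_sub]
  exact hA.resolvent_smulSub hc x

theorem resolvent_sub_resolvent (hA : IsAntiSelfAdjoint A) {c d : ℝ} (hc : c ≠ 0) (hd : d ≠ 0) :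
    hA.resolvent c - hA.resolvent d =
      ((d : ℂ) - c) • (hA.resolvent c * hA.resolvent d) := by
  ext x
  set y : A.domain := ⟨hA.resolvent d x, hA.resolvent_mem d x⟩ with hy
  have h1 : smulSub A d y = x := hA.smulSub_resolvent hd x
  have h2 : hA.resolvent c (smulSub A c y) = y := hA.resolvent_smulSub hc y
  have h3 : smulSub A d y - smulSub A c y = ((d : ℂ) - c) • (y : H) := by
    simp only [smulSub_apply, sub_smul]; abel
  have h4 : (y : H) = hA.resolvent d x := rfl
  simp only [sub_apply, smul_apply,
    mul_apply_eq_comp]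
  rw [← h4, ← map_smul, ← h3, map_sub, h2, h1]

/-- Swapping `c` and `d` in the resolvent identity changes the sign of both the difference and the
scalar factor; the factor then cancels. -/
theorem commute_resolvent (hA : IsAntiSelfAdjoint A) {c d : ℝ} (hc : c ≠ 0) (hd : d ≠ 0) :
    Commute (hA.resolvent c) (hA.resolvent d) := by
  rcases eq_or_ne c d with rfl | hcd
  · exact Commute.refl _
  have h1 := hA.resolvent_sub_resolvent hc hd
  have h2 := hA.resolvent_sub_resolvent hd hc
  have h0 : (d : ℂ) - c ≠ 0 := sub_ne_zero.2 (by exact_mod_cast hcd.symm)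
  rw [← neg_sub, h2, ← neg_smul, neg_sub] at h1
  exact (smul_right_injective _ h0 h1).symm

theorem star_resolvent (hA : IsAntiSelfAdjoint A) {c : ℝ} (hc : c ≠ 0) :
    star (hA.resolvent c) = -hA.resolvent (-c) := by
  rw [ContinuousLinearMap.star_eq_adjoint, eq_comm, ContinuousLinearMap.eq_adjoint_iff]
  intro y x
  set u : A.domain := ⟨hA.resolvent c x, hA.resolvent_mem c x⟩
  set v : A.domain := ⟨hA.resolvent (-c) y, hA.resolvent_mem (-c) y⟩
  have hu : smulSub A c u = x := hA.smulSub_resolvent hc x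
  have hv : smulSub A (-c) v = y := hA.smulSub_resolvent (neg_ne_zero.2 hc) y
  change inner ℂ (-(v : H)) x = inner ℂ y (u : H)
  rw [← hu, ← hv, smulSub_apply, smulSub_apply]
  simp only [inner_neg_left, inner_sub_left, inner_sub_right, inner_smul_left, inner_smul_right,
    hA.inner_apply_left, Complex.ofReal_neg, map_neg, Complex.conj_ofReal]
  ring

theorem tendsto_smul_resolvent (hA : IsAntiSelfAdjoint A) {c : ℕ → ℝ} (hc0 : ∀ n, c n ≠ 0)
    (hc : Tendsto (fun n => |c n|) atTop atTop) (x : H) :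
    Tendsto (fun n => (c n : ℂ) • hA.resolvent (c n) x) atTop (𝓝 x) := by
  refine tendsto_apply_self_of_dense (B := fun n => (c n : ℂ) • hA.resolvent (c n))
    (fun n x => hA.norm_smul_resolvent_le (hc0 n) x) hA.1 (fun y hy => ?_) x
  have h : ∀ n, ((c n : ℂ) • hA.resolvent (c n)) y = y + hA.resolvent (c n) (A ⟨y, hy⟩) :=
    fun n => hA.smul_resolvent_apply (hc0 n) ⟨y, hy⟩
  simp only [h]
  suffices Tendsto (fun n => hA.resolvent (c n) (A ⟨y, hy⟩)) atTop (𝓝 0) by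
    simpa using this.const_add y
  refine squeeze_zero_norm (a := fun n => |c n|⁻¹ * ‖A ⟨y, hy⟩‖) (fun n => ?_) ?_
  · have := hA.norm_smul_resolvent_le (hc0 n) (A ⟨y, hy⟩)
    rw [smul_apply, norm_smul, Complex.norm_real, Real.norm_eq_abs] at this
    rw [inv_mul_eq_div, le_div_iff₀ (abs_pos.2 (hc0 n))]
    linarith
  · simpa using (tendsto_inv_atTop_zero.comp hc).mul_const ‖A ⟨y, hy⟩‖

/-- Bounded skew-adjoint approximations of `A`, the symmetrized Yosida approximations
`½ (c A (c - A)⁻¹ + c A (c + A)⁻¹)` with `c = n + 1`. -/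
noncomputable def yosida (hA : IsAntiSelfAdjoint A) (n : ℕ) : H →L[ℂ] H :=
  (((n : ℝ) + 1) ^ 2 / 2) • (hA.resolvent ((n : ℝ) + 1) + hA.resolvent (-((n : ℝ) + 1)))

theorem yosida_mem_skewAdjoint (hA : IsAntiSelfAdjoint A) (n : ℕ) :
    hA.yosida n ∈ skewAdjoint (H →L[ℂ] H) := by
  have hn : (n : ℝ) + 1 ≠ 0 := by positivity
  refine skewAdjoint.smul_mem _ ?_
  rw [skewAdjoint.mem_iff, star_add, hA.star_resolvent hn, hA.star_resolvent (neg_ne_zero.2 hn),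
    neg_neg]
  abel

theorem commute_yosida (hA : IsAntiSelfAdjoint A) (m n : ℕ) :
    Commute (hA.yosida m) (hA.yosida n) := by
  have hm : (m : ℝ) + 1 ≠ 0 := by positivity
  have hn : (n : ℝ) + 1 ≠ 0 := by positivity
  have hm' := neg_ne_zero.2 hm
  have hn' := neg_ne_zero.2 hn
  refine (Commute.smul_left ?_ _).smul_right _
  exact ((hA.commute_resolvent hm hn).add_left (hA.commute_resolvent hm' hn)).add_right
    ((hA.commute_resolvent hm hn').add_left (hA.commute_resolvent hm' hn'))

/-- With `c = n + 1`, moving `A` through the resolvents cancels the terms `±c x` and leaves the mean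
of `c R(c) A x` and `-c R(-c) A x`, both tending to `A x`. -/
theorem tendsto_yosida (hA : IsAntiSelfAdjoint A) (x : A.domain) :
    Tendsto (fun n => hA.yosida n (x : H)) atTop (𝓝 (A x)) := by
  have hn : ∀ n : ℕ, (n : ℝ) + 1 ≠ 0 := fun n => by positivity
  have hlim : Tendsto (fun n : ℕ => |(n : ℝ) + 1|) atTop atTop :=
    tendsto_abs_atTop_atTop.comp
      (tendsto_atTop_add_const_right _ _ tendsto_natCast_atTop_atTop)
  have h1 := hA.tendsto_smul_resolvent hn hlim (A x)
  have h2 := hA.tendsto_smul_resolvent (fun n => neg_ne_zero.2 (hn n))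
    (by simpa only [abs_neg] using hlim) (A x)
  have h3 := (h1.add h2).const_smul (2⁻¹ : ℂ)
  have e : (2⁻¹ : ℂ) • (A x + A x) = A x := by
    rw [← two_smul ℂ, smul_smul]; norm_num
  rw [e] at h3
  refine h3.congr fun n => ?_
  have a1 := hA.smul_resolvent_apply (hn n) x
  have a2 := hA.smul_resolvent_apply (neg_ne_zero.2 (hn n)) x
  rw [← sub_eq_iff_eq_add'] at a1 a2
  rw [← a1, ← a2, yosida, smul_apply, add_apply,
    ← Complex.coe_smul]
  push_cast
  module

end IsAntiSelfAdjoint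

/-! ### Orbits of a strongly continuous group. -/

namespace StronglyContinuousGroup

variable {X : Type*} [NormedAddCommGroup X] [NormedSpace ℂ X] (T : StronglyContinuousGroup X)

theorem op_add_apply (s t : ℝ) (f : X) : T.op (s + t) f = T.op s (T.op t f) := by
  rw [T.op_add, mul_apply_eq_comp]

theorem hasDerivAt_zero (f : T.generator.domain) :
    HasDerivAt (fun t : ℝ => T.op t (f : X)) (T.generator f) 0 :=
  DifferentiableAt.hasDerivAt f.2

theorem exists_generator_apply_eq {f g : X} (h : HasDerivAt (fun t : ℝ => T.op t f) g 0) :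
    ∃ hf : f ∈ T.generator.domain, T.generator ⟨f, hf⟩ = g :=
  ⟨h.differentiableAt, h.deriv⟩

/-- Orbits of points of the domain of the generator stay in the domain and solve `u' = A u`. -/
theorem hasDerivAt_op_apply (f : T.generator.domain) (t : ℝ) :
    ∃ h : T.op t (f : X) ∈ T.generator.domain,
      HasDerivAt (fun s : ℝ => T.op s (f : X)) (T.generator ⟨T.op t (f : X), h⟩) t := by
  have h0 : HasDerivAt (fun s : ℝ => T.op t (T.op s (f : X))) (T.op t (T.generator f)) 0 :=
    ((T.op t).restrictScalars ℝ).hasFDerivAt.comp_hasDerivAt 0 (T.hasDerivAt_zero f)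
  obtain ⟨h, h'⟩ := T.exists_generator_apply_eq (f := T.op t (f : X)) (g := T.op t (T.generator f))
    (h0.congr_of_eventuallyEq (Eventually.of_forall fun s => by
      beta_reduce
      rw [← op_add_apply, ← op_add_apply, add_comm]))
  refine ⟨h, ?_⟩
  rw [h']
  have h1 : HasDerivAt (fun s : ℝ => T.op (t + s) (f : X)) (T.op t (T.generator f)) 0 := by
    simpa only [op_add_apply] using h0
  have h2 : HasDerivAt (fun s : ℝ => T.op (t + s) (f : X)) (T.op t (T.generator f)) (t - t) := by
    rwa [sub_self]
  have h3 := h2.comp_sub_const t t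
  simpa using h3

theorem not_isHypercyclic_of_norm_eq (hT : ∀ t f, ‖T.op t f‖ = ‖f‖) :
    ¬ IsHypercyclic (fun t : ℝ => (T.op t : X →ₗ[ℂ] X).toPMap ⊤) := by
  rintro ⟨f, hf0, hf, hd⟩
  have hmem : (0 : X) ∈ closure (Set.range fun t : ℝ => T.op t f) := hd 0
  have hsub : closure (Set.range fun t : ℝ => T.op t f) ⊆ {x | ‖x‖ = ‖f‖} :=
    closure_minimal (by rintro _ ⟨t, rfl⟩; exact hT t f)
      (isClosed_eq continuous_norm continuous_const)
  have h : ‖(0 : X)‖ = ‖f‖ := hsub hmem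
  rw [norm_zero] at h
  exact hf0 (norm_eq_zero.1 h.symm)

end StronglyContinuousGroup

/-! ### Uniqueness, construction and generator of the group. -/

namespace IsAntiSelfAdjoint

variable {H : Type*} [NormedAddCommGroup H] [InnerProductSpace ℂ H] [CompleteSpace H]
  {A : H →ₗ.[ℂ] H}

/-- Solutions of `u' = A u` have constant norm. -/
theorem norm_eq_of_hasDerivAt (hA : IsAntiSelfAdjoint A) {u : ℝ → H}
    (hu : ∀ t, ∃ h : u t ∈ A.domain, HasDerivAt u (A ⟨u t, h⟩) t) (t : ℝ) : ‖u t‖ = ‖u 0‖ := by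
  have hd : ∀ s, HasDerivAt (fun s => (inner ℂ (u s) (u s) : ℂ)) 0 s := fun s => by
    obtain ⟨h, h'⟩ := hu s
    have := h'.inner ℂ h'
    rwa [hA.inner_apply_left ⟨u s, h⟩ ⟨u s, h⟩, add_neg_cancel] at this
  have := is_const_of_deriv_eq_zero (fun s => (hd s).differentiableAt) (fun s => (hd s).deriv) t 0
  rw [inner_self_eq_norm_sq_to_K, inner_self_eq_norm_sq_to_K] at this
  have h2 : ‖u t‖ ^ 2 = ‖u 0‖ ^ 2 := by exact_mod_cast this
  exact (pow_left_inj₀ (norm_nonneg _) (norm_nonneg _) two_ne_zero).1 h2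

/-- For `f` in the domain, the difference of the two orbits solves `u' = A u` with `u 0 = 0`, so it
vanishes; density does the rest. -/
theorem group_unique (hA : IsAntiSelfAdjoint A) {S T : StronglyContinuousGroup H}
    (hS : S.generator = A) (hT : T.generator = A) : S = T := by
  ext1
  funext t
  refine ContinuousLinearMap.coeFn_injective <|
    (S.op t).continuous.ext_on hA.1 (T.op t).continuous fun f hf => ?_
  have h := hA.norm_eq_of_hasDerivAt (u := fun t => S.op t f - T.op t f) (fun s => ?_) t
  · rw [S.op_zero, T.op_zero, sub_self, norm_zero, norm_eq_zero, sub_eq_zero] at h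
    exact h
  · subst hS
    obtain ⟨h1, d1⟩ := S.hasDerivAt_op_apply ⟨f, hf⟩ s
    obtain ⟨h2, d2⟩ : ∃ h : T.op s f ∈ S.generator.domain,
        HasDerivAt (fun s : ℝ => T.op s f) (S.generator ⟨T.op s f, h⟩) s := by
      rw [← hT] at hf ⊢
      exact T.hasDerivAt_op_apply ⟨f, hf⟩ s
    refine ⟨sub_mem h1 h2, ?_⟩
    have e : S.generator ⟨S.op s f - T.op s f, sub_mem h1 h2⟩ =
        S.generator ⟨S.op s f, h1⟩ - S.generator ⟨T.op s f, h2⟩ :=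
      S.generator.map_sub ⟨S.op s f, h1⟩ ⟨T.op s f, h2⟩
    rw [e]
    exact d1.fun_sub d2

open NormedSpace

theorem cauchySeq_exp_yosida (hA : IsAntiSelfAdjoint A) (t : ℝ) (x : H) :
    CauchySeq fun n => exp (t • hA.yosida n) x := by
  refine cauchySeq_apply_of_dense
    (fun n x => (norm_exp_real_smul_apply (hA.yosida_mem_skewAdjoint n) t x).le) hA.1
    (fun y hy => ?_) x
  have hc := (hA.tendsto_yosida ⟨y, hy⟩).cauchySeq
  rw [Metric.cauchySeq_iff] at hc ⊢
  intro ε hε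
  obtain ⟨N, hN⟩ := hc (ε / (|t| + 1)) (by positivity)
  refine ⟨N, fun m hm n hn => ?_⟩
  have h := hN m hm n hn
  rw [dist_eq_norm, lt_div_iff₀ (by positivity)] at h
  rw [dist_eq_norm]
  refine (norm_exp_sub_exp_apply_le (hA.yosida_mem_skewAdjoint m) (hA.yosida_mem_skewAdjoint n)
    (hA.commute_yosida m n) t y).trans_lt (lt_of_le_of_lt ?_ h)
  gcongr
  linarith

/-- The operators `e^{tA}`, the strong limits of the exponentials of the approximations of `A`. -/
noncomputable def expOp (hA : IsAntiSelfAdjoint A) (t : ℝ) : H →L[ℂ] H :=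
  continuousLinearMapOfTendsto (fun n => exp (t • hA.yosida n))
    (tendsto_pi_nhds.2 fun x =>
      (cauchySeq_tendsto_of_complete (hA.cauchySeq_exp_yosida t x)).choose_spec)

theorem tendsto_expOp (hA : IsAntiSelfAdjoint A) (t : ℝ) (x : H) :
    Tendsto (fun n => exp (t • hA.yosida n) x) atTop (𝓝 (hA.expOp t x)) :=
  (cauchySeq_tendsto_of_complete (hA.cauchySeq_exp_yosida t x)).choose_spec

theorem norm_expOp_apply (hA : IsAntiSelfAdjoint A) (t : ℝ) (x : H) : ‖hA.expOp t x‖ = ‖x‖ := by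
  refine tendsto_nhds_unique (hA.tendsto_expOp t x).norm ?_
  simp only [norm_exp_real_smul_apply (hA.yosida_mem_skewAdjoint _) t x, tendsto_const_nhds]

theorem expOp_zero (hA : IsAntiSelfAdjoint A) : hA.expOp 0 = 1 := by
  ext x
  refine tendsto_nhds_unique (hA.tendsto_expOp 0 x) ?_
  simp

theorem expOp_add (hA : IsAntiSelfAdjoint A) (s t : ℝ) :
    hA.expOp (s + t) = hA.expOp s * hA.expOp t := by
  let _ := NormedAlgebra.restrictScalars ℚ ℂ (H →L[ℂ] H)
  ext x
  refine tendsto_nhds_unique (hA.tendsto_expOp (s + t) x) ?_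
  have h1 : Tendsto (fun n => exp (s • hA.yosida n) (hA.expOp t x)) atTop
      (𝓝 (hA.expOp s (hA.expOp t x))) := hA.tendsto_expOp s _
  -- Strong limits pass through the product because the outer factors are isometries.
  have h2 : Tendsto (fun n => exp (s • hA.yosida n) (exp (t • hA.yosida n) x - hA.expOp t x))
      atTop (𝓝 0) := by
    rw [tendsto_zero_iff_norm_tendsto_zero]
    simp only [norm_exp_real_smul_apply (hA.yosida_mem_skewAdjoint _)]
    rw [← tendsto_zero_iff_norm_tendsto_zero]
    simpa using (hA.tendsto_expOp t x).sub_const (hA.expOp t x)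
  have h3 := h1.add h2
  rw [add_zero] at h3
  refine h3.congr fun n => ?_
  rw [← map_add, add_sub_cancel, add_smul, exp_add_of_commute, mul_apply_eq_comp]
  exact ((Commute.refl _).smul_left s).smul_right t

theorem norm_expOp_apply_sub_le (hA : IsAntiSelfAdjoint A) (t : ℝ) (x : A.domain) :
    ‖hA.expOp t x - x‖ ≤ ‖A x‖ * |t| :=
  le_of_tendsto_of_tendsto' ((hA.tendsto_expOp t x).sub_const _).norm
    ((hA.tendsto_yosida x).norm.mul_const _)
    fun n => norm_exp_real_smul_apply_sub_le (hA.yosida_mem_skewAdjoint n) t x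

theorem norm_expOp_apply_sub_sub_le (hA : IsAntiSelfAdjoint A) (t : ℝ) (x h : A.domain) :
    ‖hA.expOp t x - x - t • A x‖ ≤ (2 * ‖A x - h‖ + ‖A h‖ * |t|) * |t| := by
  have := le_of_tendsto_of_tendsto' (((hA.tendsto_expOp t x).sub_const _).sub_const (t • A x)).norm
    (((((hA.tendsto_yosida x).sub_const (A x)).norm).add
      (((hA.tendsto_yosida h).norm.mul_const |t|).const_add (2 * ‖A x - h‖))).mul_const |t|)
    fun n => norm_exp_real_smul_apply_sub_sub_le (hA.yosida_mem_skewAdjoint n) t x (A x) h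
  simpa using this

theorem continuous_expOp_apply (hA : IsAntiSelfAdjoint A) (x : H) :
    Continuous fun t => hA.expOp t x := by
  have h0 : Tendsto (fun t => hA.expOp t x) (𝓝 0) (𝓝 x) := by
    refine tendsto_apply_self_of_dense (fun t x => (hA.norm_expOp_apply t x).le) hA.1
      (fun y hy => ?_) x
    rw [tendsto_iff_norm_sub_tendsto_zero]
    refine squeeze_zero (fun _ => norm_nonneg _)
      (fun t => hA.norm_expOp_apply_sub_le t ⟨y, hy⟩) ?_
    have : Continuous fun t : ℝ => ‖A ⟨y, hy⟩‖ * |t| := by fun_prop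
    simpa using this.tendsto 0
  refine continuous_iff_continuousAt.2 fun t => ?_
  have h1 : Tendsto (fun s => hA.expOp t (hA.expOp (s - t) x)) (𝓝 t) (𝓝 (hA.expOp t x)) := by
    refine ((hA.expOp t).continuous.tendsto x).comp (h0.comp ?_)
    exact (continuous_sub_right t).tendsto' t 0 (sub_self t)
  refine h1.congr fun s => ?_
  rw [← mul_apply_eq_comp, ← hA.expOp_add, add_sub_cancel]

theorem hasDerivAt_expOp_apply_zero (hA : IsAntiSelfAdjoint A) (x : A.domain) :
    HasDerivAt (fun t : ℝ => hA.expOp t (x : H)) (A x) 0 := by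
  rw [hasDerivAt_iff_isLittleO_nhds_zero, Asymptotics.isLittleO_iff]
  intro ε hε
  -- The error bound is `2‖A x - h‖ + ‖A h‖|t|`: `ε / 4` makes the first term less than `ε / 2`, and
  -- small `t` handles the second.
  obtain ⟨h, hh, hd⟩ := hA.1.exists_dist_lt (A x) (show 0 < ε / 4 by positivity)
  have hcont : Continuous fun t : ℝ => ‖A ⟨h, hh⟩‖ * |t| := by fun_prop
  have hsmall : ∀ᶠ t : ℝ in 𝓝 0, ‖A ⟨h, hh⟩‖ * |t| < ε / 2 :=
    (hcont.tendsto' 0 0 (by simp)).eventually_lt_const (by positivity)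
  filter_upwards [hsmall] with t ht
  have := hA.norm_expOp_apply_sub_sub_le t x ⟨h, hh⟩
  rw [zero_add, hA.expOp_zero, one_apply_eq_self, Real.norm_eq_abs]
  refine this.trans ?_
  rw [dist_eq_norm] at hd
  gcongr
  dsimp only
  linarith

/-- The strongly continuous group `e^{tA}` generated by an anti-self-adjoint operator `A`. -/
noncomputable def expGroup (hA : IsAntiSelfAdjoint A) : StronglyContinuousGroup H where
  op := hA.expOp
  op_zero := hA.expOp_zero
  op_add := hA.expOp_add
  continuous_orbit := hA.continuous_expOp_apply

theorem expOp_mem_unitary (hA : IsAntiSelfAdjoint A) (t : ℝ) :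
    hA.expOp t ∈ unitary (H →L[ℂ] H) := by
  have h : star (hA.expOp t) * hA.expOp t = 1 :=
    (ContinuousLinearMap.norm_map_iff_adjoint_comp_self _).1 (hA.norm_expOp_apply t)
  -- An isometry need not be onto; invertibility comes from the group law, with inverse `expOp
  -- (-t)`.
  refine IsUnit.mem_unitary_of_star_mul_self ?_ h
  refine ⟨⟨hA.expOp t, hA.expOp (-t), ?_, ?_⟩, rfl⟩ <;>
    rw [← hA.expOp_add] <;> simp [hA.expOp_zero]

theorem generator_expGroup (hA : IsAntiSelfAdjoint A) : hA.expGroup.generator = A := by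
  have hle : A ≤ hA.expGroup.generator := by
    refine ⟨fun x hx => ((hA.hasDerivAt_expOp_apply_zero ⟨x, hx⟩).differentiableAt), ?_⟩
    intro x y hxy
    obtain ⟨h, h'⟩ := hA.expGroup.exists_generator_apply_eq (hA.hasDerivAt_expOp_apply_zero x)
    rw [← h']
    congr 1
    exact Subtype.ext hxy
  refine (LinearPMap.eq_of_le_of_domain_eq hle (le_antisymm hle.1 fun f hf => ?_)).symm
  -- Differentiating the constant `⟨e^{tA} f, e^{tA} g⟩` at `0` yields the weak equation needed
  -- here.
  refine (hA.exists_apply_eq (x := f) (y := hA.expGroup.generator ⟨f, hf⟩) fun g => ?_).choose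
  have d1 : HasDerivAt (fun t : ℝ => hA.expOp t f) (hA.expGroup.generator ⟨f, hf⟩) 0 :=
    hA.expGroup.hasDerivAt_zero ⟨f, hf⟩
  have d := d1.inner ℂ (hA.hasDerivAt_expOp_apply_zero g)
  have hconst : ∀ t, inner ℂ (hA.expOp t f) (hA.expOp t (g : H)) = inner ℂ f (g : H) := fun t =>
    ContinuousLinearMap.inner_map_map_of_mem_unitary (hA.expOp_mem_unitary t) _ _
  simp only [hconst] at d
  have := d.unique (hasDerivAt_const _ _)
  rw [hA.expOp_zero, one_apply_eq_self, one_apply_eq_self] at this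
  exact eq_neg_of_add_eq_zero_right this

end IsAntiSelfAdjoint

theorem corollary4p2 {H : Type*} [NormedAddCommGroup H] [InnerProductSpace ℂ H] [CompleteSpace H]
    (A : H →ₗ.[ℂ] H) (hA : IsAntiSelfAdjoint A) :
    ∃ T : StronglyContinuousGroup H,
      (T.generator = A ∧ ∀ S : StronglyContinuousGroup H, S.generator = A → S = T) ∧
      (∀ t : ℝ, T.op t ∈ unitary (H →L[ℂ] H)) ∧
      (∃ M : ℝ, ∀ t : ℝ, ‖T.op t‖ ≤ M) ∧
      ¬ IsHypercyclic (fun t : ℝ => (T.op t : H →ₗ[ℂ] H).toPMap ⊤) :=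
  ⟨hA.expGroup,
    ⟨hA.generator_expGroup, fun _ hS => hA.group_unique hS hA.generator_expGroup⟩,
    hA.expOp_mem_unitary,
    ⟨1, fun t => ContinuousLinearMap.opNorm_le_bound _ zero_le_one fun x => by
      rw [one_mul]; exact (hA.norm_expOp_apply t x).le⟩,
    hA.expGroup.not_isHypercyclic_of_norm_eq hA.norm_expOp_apply⟩
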